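/- **Conventions.** A representation of a set $X$ is a surjective partial function $\delta_X:\subseteq\mathbb{N}^{\mathbb{N}}\to X$, and a represented space is a set with a representation. Multi-valued functions $f:\subseteq X\rightrightarrows Y$ are partial, with $\mathrm{dom}(f)=\{x: f(x)\neq\emptyset\}$; composition is given by $\mathrm{dom}(g\circ f)=\{x\in\mathrm{dom}(f): f(x)\subseteq\mathrm{dom}(g)\}$ and $(g\circ f)(x)=\bigcup_{y\in f(x)}g(y)$. On $\mathbb{N}^{\mathbb{N}}$ let $\langle p,q\rangle(2n)=p(n)$, $\langle p,q\rangle(2n+1)=q(n)$, and let $\langle p_0,p_1,\dots\rangle\langle i,k\rangle=p_i(k)$ for a standard bijective pairing $\langle i,k\rangle$ of natural numbers; products of represented spaces carry the representation $\langle p,q\rangle\mapsto(\delta_X(p),\delta_Y(q))$, $\mathbb{N}^{\mathbb{N}}$ is represented by its identity, and $(f\times g)(x,z)=f(x)\times g(z)$. A realizer of $f$ (written $F\vdash f$) is a partial function $F:\subseteq\mathbb{N}^{\mathbb{N}}\to\mathbb{N}^{\mathbb{N}}$ such that $\delta_YF(p)\in f(\delta_X(p))$ for all $p\in\mathrm{dom}(f\delta_X)$.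 One writes $f\le_W g$ if there are computable $K,H:\subseteq\mathbb{N}^{\mathbb{N}}\to\mathbb{N}^{\mathbb{N}}$ such that $p\mapsto K\langle p,GH(p)\rangle$ realizes $f$ for every $G\vdash g$, and $f\le_{sW}g$ if there are such $K,H$ with $KGH\vdash f$ for every $G\vdash g$. The equivalences $\equiv_W$ and $\equiv_{sW}$ mean reducibility in both directions. Let $\lim:\subseteq\mathbb{N}^{\mathbb{N}}\to\mathbb{N}^{\mathbb{N}}$, $\langle p_0,p_1,\dots\rangle\mapsto\lim_i p_i$. The derivative $g'$ of $g:\subseteq(Z,\delta_Z)\rightrightarrows(W,\delta_W)$ is the same multi-valued function, considered as $g':\subseteq(Z,\delta_Z\circ\lim)\rightrightarrows(W,\delta_W)$. A multi-valued function $g$ is a cylinder if $g\equiv_{sW}\mathrm{id}\times g$, where $\mathrm{id}$ is the identity on $\mathbb{N}^{\mathbb{N}}$. For $f,h:\subseteq X\rightrightarrows Y$ write $f\sqsupseteq h$ if $\mathrm{dom}(f)\subseteq\mathrm{dom}(h)$ and $h(x)\subseteq f(x)$ for all $x\in\mathrm{dom}(f)$. The compositional product $f*g$ is the supremum with respect to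 $\le_W$, if it exists, of all compositions $f_0\circ g_0$ (of compatible types) with $f_0\le_W f$ and $g_0\le_W g$; the strong compositional product $f*_s g$ is defined in the same way with $\le_{sW}$ in place of $\le_W$ throughout. Both are determined up to (strong) equivalence. **Theorem (Derivatives).** Let $g$ be a multi-valued function on represented spaces. 1. If $g$ is a cylinder, then for every multi-valued function $f$ on represented spaces: $f\le_W g'$ if and only if $f=g_0\circ l_0$ for some multi-valued functions $g_0\le_W g$ and $l_0\le_W\lim$ on represented spaces. 2. Whether or not $g$ is a cylinder, for every multi-valued function $f$ on represented spaces the following are equivalent: (a) $f\le_{sW}g'$; (b) $f\sqsupseteq g_0\circ l_0$ for some $g_0\le_{sW}g$ and $l_0\le_{sW}\lim$; (c) $f\le_{sW}g_0\circ l_0$ for some $g_0\le_{sW}g$ and $l_0\le_{sW}\lim$. 3. If $g$ is a cylinder, then $g*\lim$ exists and $g'\equiv_W g*\lim$. For arbitrary $g$, $g*_s\lim$ exists and $g'\equiv_{sW}g*_s\lim$. -/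

import Mathlib

universe u

namespace Weihrauch

universe v u₁ u₂ u₃ u₄

/-! ### Baire space and computable partial functions on it -/

/-- Baire space `ℕ^ℕ`; it carries the product topology of the discrete topologies. -/
abbrev Baire : Type := ℕ → ℕ

/-- The finite prefix `p(0), …, p(n-1)` of `p`. -/
def initSeg (p : Baire) (n : ℕ) : List ℕ := (List.range n).map p

/-- Type-2 computability of a partial function `F` on Baire space: some computable word function
`φ` that is monotone for the prefix order approximates `F`, that is, if `F p = q` then the words
`φ (p(0) … p(k-1))`, for `k = 0, 1, 2, …`, converge to `q`.
(Restrictions of computable functions are computable with this convention.) -/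
def BaireComputable (F : Baire →. Baire) : Prop :=
  ∃ φ : List ℕ → List ℕ, Computable φ ∧ (∀ s t : List ℕ, s <+: t → φ s <+: φ t) ∧
    ∀ p q : Baire, q ∈ F p → ∀ n : ℕ, ∃ k : ℕ, initSeg q n <+: φ (initSeg p k)

/-- The pairing `⟨p, q⟩(2n) = p(n)`, `⟨p, q⟩(2n+1) = q(n)`. -/
def pair (p q : Baire) : Baire := fun n => if n % 2 = 0 then p (n / 2) else q (n / 2)

/-- `fst ⟨p, q⟩ = p`. -/
def fst (r : Baire) : Baire := fun n => r (2 * n)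

/-- `snd ⟨p, q⟩ = q`. -/
def snd (r : Baire) : Baire := fun n => r (2 * n + 1)

theorem fst_pair (p q : Baire) : fst (pair p q) = p := by
  funext n
  simp [fst, pair]

theorem snd_pair (p q : Baire) : snd (pair p q) = q := by
  funext n
  have h1 : (2 * n + 1) % 2 = 1 := by omega
  have h2 : (2 * n + 1) / 2 = n := by omega
  simp [snd, pair, h1, h2]

/-- `p` codes a sequence `p₀, p₁, …` with `pᵢ(k) = p⟨i, k⟩`, and that sequence converges to `q`
in Baire space. -/
def LimitOf (p q : Baire) : Prop :=
  Filter.Tendsto (fun i : ℕ => (fun k : ℕ => p (Nat.pair i k) : Baire)) Filter.atTop (nhds q)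

/-- The partial limit function `⟨p₀, p₁, p₂, …⟩ ↦ lim pᵢ` on Baire space. -/
noncomputable def limFun : Baire →. Baire := fun p => ⟨∃ q, LimitOf p q, fun h => h.choose⟩

theorem mem_limFun {p q : Baire} : q ∈ limFun p ↔ LimitOf p q := by
  constructor
  · rintro ⟨h, rfl⟩
    exact h.choose_spec
  · intro h
    have h' : ∃ q, LimitOf p q := ⟨q, h⟩
    exact ⟨h', tendsto_nhds_unique h'.choose_spec h⟩

theorem limFun_surj (q : Baire) : ∃ p, q ∈ limFun p :=
  ⟨fun n => q n.unpair.2, mem_limFun.2 (by simp [LimitOf])⟩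

/-! ### Represented spaces -/

/-- A represented space: a set with a surjective partial function from Baire space onto it. -/
structure RepSpace where
  /-- the underlying set -/
  carrier : Type u
  /-- the representation; `x ∈ δ p` says that `p` is a name of `x` -/
  δ : Baire →. carrier
  /-- every point has a name -/
  surj : ∀ x : carrier, ∃ p : Baire, x ∈ δ p

/-- Baire space, represented by the identity. -/
def baireSpace : RepSpace.{0} where
  carrier := Baire
  δ := fun p => Part.some p
  surj := fun x => ⟨x, Part.mem_some x⟩

/-- The same set, with the jump `δ' = δ ∘ lim` of the representation. -/
noncomputable def RepSpace.jump (X : RepSpace.{u}) : RepSpace.{u} where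
  carrier := X.carrier
  δ := fun p => (limFun p).bind X.δ
  surj := fun x => by
    obtain ⟨q, hq⟩ := X.surj x
    obtain ⟨p, hp⟩ := limFun_surj q
    exact ⟨p, Part.mem_bind hp hq⟩

/-- The product set, with the product representation: `⟨p, q⟩` is a name of `(x, y)` if and only
if `p` is a name of `x` and `q` is a name of `y`. -/
def RepSpace.prod (X : RepSpace.{u}) (Y : RepSpace.{v}) : RepSpace.{max u v} where
  carrier := X.carrier × Y.carrier
  δ := fun r => (X.δ (fst r)).bind fun x => (Y.δ (snd r)).map fun y => (x, y)
  surj := fun z => by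
    obtain ⟨p, hp⟩ := X.surj z.1
    obtain ⟨q, hq⟩ := Y.surj z.2
    refine ⟨pair p q, Part.mem_bind (a := z.1) ?_ ?_⟩
    · rw [fst_pair]
      exact hp
    · rw [snd_pair]
      exact Part.mem_map (fun y => (z.1, y)) hq

/-! ### Multi-valued functions -/

/-- A partial multi-valued function `f :⊆ X ⇉ Y` between represented spaces; its domain is the
set of the points with a non-empty set of values. -/
@[ext] structure MVFun (X : RepSpace.{u}) (Y : RepSpace.{v}) where
  /-- the set of values at a point -/
  val : X.carrier → Set Y.carrier

namespace MVFun

/-- The domain `{x | f(x) ≠ ∅}`. -/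
def dom {X : RepSpace.{u₁}} {Y : RepSpace.{u₂}} (f : MVFun X Y) : Set X.carrier :=
  {x | (f.val x).Nonempty}

/-- The composition `g ∘ f` of multi-valued functions, with
`dom (g ∘ f) = {x ∈ dom f | f(x) ⊆ dom g}` and `(g ∘ f)(x) = ⋃ y ∈ f(x), g(y)` there. -/
def comp {X : RepSpace.{u₁}} {Y : RepSpace.{u₂}} {Z : RepSpace.{u₃}}
    (g : MVFun Y Z) (f : MVFun X Y) : MVFun X Z where
  val x := {z | f.val x ⊆ g.dom ∧ ∃ y ∈ f.val x, z ∈ g.val y}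

/-- `f ⊒ h`: `dom f ⊆ dom h`, and `h(x) ⊆ f(x)` for all `x ∈ dom f`. -/
def Extends {X : RepSpace.{u₁}} {Y : RepSpace.{u₂}} (f h : MVFun X Y) : Prop :=
  f.dom ⊆ h.dom ∧ ∀ x ∈ f.dom, h.val x ⊆ f.val x

/-- The product `(f × g)(x, z) = f(x) × g(z)`. -/
def prod {X : RepSpace.{u₁}} {Y : RepSpace.{u₂}} {Z : RepSpace.{u₃}} {W : RepSpace.{u₄}}
    (f : MVFun X Y) (g : MVFun Z W) : MVFun (X.prod Z) (Y.prod W) where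
  val a := f.val a.1 ×ˢ g.val a.2

/-- The derivative (jump) of `f`: the same multi-valued function, where the input space carries
the jump of its representation. -/
noncomputable def derivative {X : RepSpace.{u₁}} {Y : RepSpace.{u₂}} (f : MVFun X Y) :
    MVFun X.jump Y where
  val := f.val

/-- `Realizes F f`: the partial function `F` on Baire space is a realizer of `f`, that is, `F p`
is defined and a name of a point of `f(x)` whenever `p` is a name of `x ∈ dom f`. -/
def Realizes {X : RepSpace.{u₁}} {Y : RepSpace.{u₂}} (F : Baire →. Baire) (f : MVFun X Y) : Prop :=
  ∀ (p : Baire) (x : X.carrier), x ∈ X.δ p → x ∈ f.dom → ∃ q ∈ F p, ∃ y ∈ Y.δ q, y ∈ f.val x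

/-- Weihrauch reducibility: there are computable `K`, `H` such that `p ↦ K⟨p, G(H(p))⟩` realizes
`f` for every realizer `G` of `g`. -/
def WReducible {X : RepSpace.{u₁}} {Y : RepSpace.{u₂}} {Z : RepSpace.{u₃}} {W : RepSpace.{u₄}}
    (f : MVFun X Y) (g : MVFun Z W) : Prop :=
  ∃ K H : Baire →. Baire, BaireComputable K ∧ BaireComputable H ∧
    ∀ G : Baire →. Baire, Realizes G g →
      Realizes (fun p => (H p).bind fun a => (G a).bind fun b => K (pair p b)) f

/-- Strong Weihrauch reducibility: there are computable `K`, `H` such that `p ↦ K(G(H(p)))`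
realizes `f` for every realizer `G` of `g`. -/
def SWReducible {X : RepSpace.{u₁}} {Y : RepSpace.{u₂}} {Z : RepSpace.{u₃}} {W : RepSpace.{u₄}}
    (f : MVFun X Y) (g : MVFun Z W) : Prop :=
  ∃ K H : Baire →. Baire, BaireComputable K ∧ BaireComputable H ∧
    ∀ G : Baire →. Baire, Realizes G g →
      Realizes (fun p => (H p).bind fun a => (G a).bind K) f

/-- The identity on Baire space. -/
def idBaire : MVFun baireSpace baireSpace where
  val p := {p}

/-- The limit operation `lim` on Baire space. -/
def lim : MVFun baireSpace baireSpace where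
  val p := {q : Baire | q ∈ limFun p}

/-- `g` is a cylinder: `g` is strongly Weihrauch equivalent to `id × g`. -/
def IsCylinder {Z : RepSpace.{u₁}} {W : RepSpace.{u₂}} (g : MVFun Z W) : Prop :=
  g.SWReducible (idBaire.prod g) ∧ (idBaire.prod g).SWReducible g

/-! ### Compositional products -/

/-- `k` is an upper bound, for Weihrauch reducibility, of all compositions `f₀ ∘ g₀` (of compatible
types) with `f₀ ≤ f` and `g₀ ≤ g`. -/
def IsCompBound {C D : RepSpace.{u}} {X Y : RepSpace.{u₁}} {Z W : RepSpace.{u₂}}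
    (k : MVFun C D) (f : MVFun X Y) (g : MVFun Z W) : Prop :=
  ∀ (A V B : RepSpace.{u}) (f₀ : MVFun V B) (g₀ : MVFun A V),
    f₀.WReducible f → g₀.WReducible g → (f₀.comp g₀).WReducible k

/-- The compositional product `f * g` exists, and `h` is a representative of it: `h` is a least
upper bound, for Weihrauch reducibility, of the compositions `f₀ ∘ g₀` with `f₀ ≤ f`, `g₀ ≤ g`. -/
def IsCompProduct {P Q : RepSpace.{u}} {X Y : RepSpace.{u₁}} {Z W : RepSpace.{u₂}}
    (h : MVFun P Q) (f : MVFun X Y) (g : MVFun Z W) : Prop :=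
  IsCompBound h f g ∧
    ∀ (C D : RepSpace.{u}) (k : MVFun C D), IsCompBound k f g → h.WReducible k

/-- As `IsCompBound`, with strong Weihrauch reducibility throughout. -/
def IsStrongCompBound {C D : RepSpace.{u}} {X Y : RepSpace.{u₁}} {Z W : RepSpace.{u₂}}
    (k : MVFun C D) (f : MVFun X Y) (g : MVFun Z W) : Prop :=
  ∀ (A V B : RepSpace.{u}) (f₀ : MVFun V B) (g₀ : MVFun A V),
    f₀.SWReducible f → g₀.SWReducible g → (f₀.comp g₀).SWReducible k

/-- The strong compositional product of `f` and `g` exists, and `h` is a representative of it. -/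
def IsStrongCompProduct {P Q : RepSpace.{u}} {X Y : RepSpace.{u₁}} {Z W : RepSpace.{u₂}}
    (h : MVFun P Q) (f : MVFun X Y) (g : MVFun Z W) : Prop :=
  IsStrongCompBound h f g ∧
    ∀ (C D : RepSpace.{u}) (k : MVFun C D), IsStrongCompBound k f g → h.SWReducible k

end MVFun

end Weihrauch

namespace Weihrauch

/-! ### Finite prefixes -/

/-! A name for an instance of `g'` is a sequence converging to a name for an instance of `g`, so on
names `g'` is `g` applied after `lim`. In a composition `g₀ ∘ l₀`, only a computable map stands
between the use of `lim` and the use of `g`. Computable maps can be moved in front of a limit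
(`exists_lim_lift`), so one call of `g'` suffices (`comp_swReducible_derivative`). This settles the
strong case. In the other case a cylinder makes reductions to `g` strong, and `lim` can carry the
original input along, so reductions to it are strong as well. Conversely, a reduction of `f` to `g'`
is cut at the limit of `H p`, with names as intermediate points. Ordinary reductions may keep `p` in
that point, which yields equality (`exists_eq_comp`, for any `g`); strong ones may not, which yields
only `⊒` (`exists_extends_comp`). Cutting `g'` itself shows that it lies below every upper bound of
the compositions. -/

@[simp] theorem length_initSeg (p : Baire) (n : ℕ) : (initSeg p n).length = n := by
  simp [initSeg]

theorem getElem?_initSeg (p : Baire) {n i : ℕ} (h : i < n) : (initSeg p n)[i]? = some (p i) := by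
  simp [initSeg, h]

theorem initSeg_congr {p q : Baire} {n : ℕ} (h : ∀ i < n, p i = q i) :
    initSeg p n = initSeg q n :=
  List.map_congr_left fun i hi => h i (List.mem_range.1 hi)

theorem initSeg_prefix (p : Baire) {m n : ℕ} (h : m ≤ n) : initSeg p m <+: initSeg p n := by
  obtain ⟨k, rfl⟩ := Nat.exists_eq_add_of_le h
  rw [initSeg, initSeg, List.range_add, List.map_append]
  exact List.prefix_append _ _

/-- The extension of a finite word by zeros. -/
def zeroExt (w : List ℕ) : Baire := fun i => w.getD i 0

theorem zeroExt_eq_of_prefix {w w' : List ℕ} (h : w <+: w') {i : ℕ} (hi : i < w.length) :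
    zeroExt w' i = zeroExt w i := by
  obtain ⟨t, rfl⟩ := h
  simp [zeroExt, List.getElem?_append_left hi]

theorem zeroExt_initSeg (p : Baire) {n i : ℕ} (hi : i < n) : zeroExt (initSeg p n) i = p i := by
  simp [zeroExt, getElem?_initSeg p hi]

theorem zeroExt_of_initSeg_prefix {p : Baire} {n i : ℕ} {w : List ℕ} (h : initSeg p n <+: w)
    (hi : i < n) : zeroExt w i = p i := by
  rw [zeroExt_eq_of_prefix h (by simpa using hi), zeroExt_initSeg p hi]

/-! ### Computability of functions on Baire space -/

theorem computable_initSeg {α : Type*} [Primcodable α] {F : α → Baire} {n : α → ℕ}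
    (hF : Computable₂ fun a j => F a j) (hn : Computable n) :
    Computable fun a => initSeg (F a) (n a) := by
  have h : Computable₂ fun (a : α) (x : ℕ × List ℕ) => x.2 ++ [F a x.1] :=
    (Computable.list_concat.comp (Computable.snd.comp Computable.snd)
      (hF.comp Computable.fst (Computable.fst.comp Computable.snd))).to₂
  refine (Computable.nat_rec hn (Computable.const []) h).of_eq fun a => ?_
  induction n a with
  | zero => rfl
  | succ k ih => simp only [ih]; simp [initSeg, List.range_succ]

theorem computable_zeroExt : Computable₂ fun w i => zeroExt w i :=
  (Primrec.list_getD 0).to_comp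

theorem computable_sq_bound : Computable fun n : ℕ => Nat.sqrt n - 1 :=
  (Primrec.nat_sub.comp Primrec.nat_sqrt (Primrec.const 1)).to_comp

theorem computable_ite_even {α : Type*} [Primcodable α] {n f g : α → ℕ}
    (hn : Computable n) (hf : Computable f) (hg : Computable g) :
    Computable fun a => if n a % 2 = 0 then f a else g a := by
  refine (Computable.cond (Computable.nat_bodd.comp hn) hg hf).of_eq fun a => ?_
  rw [Nat.mod_two_of_bodd]
  cases (n a).bodd <;> simp

theorem computable_half {α : Type*} [Primcodable α] {n : α → ℕ} (hn : Computable n) :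
    Computable fun a => n a / 2 :=
  (Computable.nat_div2.comp hn).of_eq fun _ => Nat.div2_val _

/-- A total function whose `j`-th digit is computable from the first `(j + 2) ^ 2` digits of the
input is computable. -/
theorem BaireComputable.of_local {F : Baire → Baire}
    (hl : ∀ p q : Baire, ∀ j, (∀ i < (j + 2) ^ 2, p i = q i) → F p j = F q j)
    (hc : Computable₂ fun w j => F (zeroExt w) j) :
    BaireComputable fun p => Part.some (F p) := by
  -- A word of length `n` determines the digits `j < √n - 1`, so only these are output and the zero
  -- padding is never seen. A quadratic bound is chosen because `Nat.pair` grows quadratically.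
  have key : ∀ {n j : ℕ}, j < Nat.sqrt n - 1 → (j + 2) ^ 2 ≤ n := fun {n j} h =>
    (Nat.pow_le_pow_left (by omega : j + 2 ≤ Nat.sqrt n) 2).trans (Nat.sqrt_le' n)
  refine ⟨fun w => initSeg (F (zeroExt w)) (Nat.sqrt w.length - 1),
    computable_initSeg hc (computable_sq_bound.comp Computable.list_length), ?_, ?_⟩
  · intro s t h
    have hlen := h.length_le
    have : initSeg (F (zeroExt s)) (Nat.sqrt s.length - 1)
        = initSeg (F (zeroExt t)) (Nat.sqrt s.length - 1) :=
      initSeg_congr fun j hj => hl _ _ _ fun i hi =>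
        (zeroExt_eq_of_prefix h (hi.trans_le (key hj))).symm
    dsimp only
    rw [this]
    exact initSeg_prefix _ (Nat.sub_le_sub_right (Nat.sqrt_le_sqrt hlen) 1)
  · intro p q hq n
    obtain rfl := Part.mem_some_iff.1 hq
    refine ⟨(n + 1) ^ 2, ?_⟩
    have hn : Nat.sqrt (initSeg p ((n + 1) ^ 2)).length - 1 = n := by simp [Nat.sqrt_eq']
    dsimp only
    rw [hn]
    refine (initSeg_congr fun j hj => hl _ _ _ fun i hi => ?_).symm ▸ List.prefix_refl _
    exact (zeroExt_initSeg p
      (hi.trans_le (Nat.pow_le_pow_left (by omega : j + 2 ≤ n + 1) 2))).symm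

theorem BaireComputable.comp {F G : Baire →. Baire} (hF : BaireComputable F)
    (hG : BaireComputable G) : BaireComputable fun p => (G p).bind F := by
  obtain ⟨φ, hφ, mφ, aφ⟩ := hF
  obtain ⟨ψ, hψ, mψ, aψ⟩ := hG
  refine ⟨fun w => φ (ψ w), hφ.comp hψ, fun s t h => mφ _ _ (mψ _ _ h), fun p r hr n => ?_⟩
  obtain ⟨q, hq, hr⟩ := Part.mem_bind_iff.1 hr
  obtain ⟨m, hm⟩ := aφ q r hr n
  obtain ⟨k, hk⟩ := aψ p q hq m
  exact ⟨k, hm.trans (mφ _ _ hk)⟩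

theorem BaireComputable.id : BaireComputable fun p => Part.some p :=
  .of_local (fun _ _ j h => h j (by nlinarith)) computable_zeroExt

theorem BaireComputable.snd : BaireComputable fun p => Part.some (snd p) := by
  refine .of_local (fun _ _ j h => h _ (by nlinarith)) ?_
  exact computable_zeroExt.comp Computable.fst
    ((Primrec.nat_add.comp (Primrec.nat_mul.comp (Primrec.const 2) Primrec.snd)
      (Primrec.const 1)).to_comp)

theorem computable_pair {α : Type*} [Primcodable α] {F G : α → Baire}
    (hF : Computable₂ fun a j => F a j) (hG : Computable₂ fun a j => G a j) :
    Computable₂ fun a j => pair (F a) (G a) j :=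
  computable_ite_even Computable.snd (hF.comp Computable.fst (computable_half Computable.snd))
    (hG.comp Computable.fst (computable_half Computable.snd))

/-- `⟨⟨p, q⟩, r⟩ ↦ ⟨p, r⟩` is computable. -/
theorem BaireComputable.pair_fst_fst_snd :
    BaireComputable fun u => Part.some (pair (fst (fst u)) (Weihrauch.snd u)) := by
  refine .of_local (fun p q j h => ?_) (computable_pair ?_ ?_)
  · have := Nat.div_mul_le_self j 2
    unfold pair fst Weihrauch.snd
    split_ifs
    · exact h _ (by nlinarith)
    · exact h _ (by nlinarith)
  · exact computable_zeroExt.comp Computable.fst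
      ((Primrec.nat_mul.comp (Primrec.const 2)
        (Primrec.nat_mul.comp (Primrec.const 2) Primrec.snd)).to_comp)
  · exact computable_zeroExt.comp Computable.fst
      ((Primrec.nat_add.comp (Primrec.nat_mul.comp (Primrec.const 2) Primrec.snd)
        (Primrec.const 1)).to_comp)

/-- The pairing of the identity with a computable function is computable. -/
theorem BaireComputable.pair_id {H : Baire →. Baire} (hH : BaireComputable H) :
    BaireComputable fun p => (H p).map (pair p) := by
  obtain ⟨φ, hφ, mφ, aφ⟩ := hH
  have key : ∀ {j m : ℕ}, j < 2 * m → j / 2 < m := by intros; omega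
  -- Cutting at twice the shorter length keeps only digits that both words really supply, which
  -- makes the word function monotone.
  refine ⟨fun w => initSeg (pair (zeroExt w) (zeroExt (φ w))) (2 * min w.length (φ w).length),
    computable_initSeg (computable_pair computable_zeroExt
      (computable_zeroExt.comp (hφ.comp Computable.fst) Computable.snd))
      (Primrec.nat_mul.to_comp.comp (Computable.const 2) (Primrec.nat_min.to_comp.comp
        Computable.list_length (Computable.list_length.comp hφ))), ?_, ?_⟩
  · intro s t h
    have h' := mφ _ _ h
    have := h.length_le
    have := h'.length_le
    refine List.IsPrefix.trans ?_ (initSeg_prefix (pair (zeroExt t) (zeroExt (φ t)))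
      (show 2 * min s.length (φ s).length ≤ _ by omega))
    refine (initSeg_congr fun j hj => ?_) ▸ List.prefix_refl _
    have hj := key hj
    unfold pair
    rw [zeroExt_eq_of_prefix h (by omega), zeroExt_eq_of_prefix h' (by omega)]
  · intro p r hr n
    obtain ⟨q, hq, rfl⟩ := (Part.mem_map_iff _).1 hr
    obtain ⟨k, hk⟩ := aφ p q hq n
    have hk' := hk.trans (mφ _ _ (initSeg_prefix p (le_max_left k n)))
    refine ⟨max k n, ?_⟩
    have hlen := hk'.length_le
    rw [length_initSeg] at hlen
    refine List.IsPrefix.trans ?_ (initSeg_prefix _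
      (show n ≤ 2 * min (initSeg p (max k n)).length (φ (initSeg p (max k n))).length by
        rw [length_initSeg]; omega))
    refine (initSeg_congr fun j hj => ?_) ▸ List.prefix_refl _
    unfold pair
    rw [zeroExt_initSeg p (by omega), zeroExt_of_initSeg_prefix hk' (by omega)]

/-! ### Computable functions and limits -/

theorem limitOf_iff {p q : Baire} :
    LimitOf p q ↔ ∀ k, ∀ᶠ i in Filter.atTop, p (Nat.pair i k) = q k := by
  simp [LimitOf, tendsto_pi_nhds, nhds_discrete, Filter.tendsto_pure]

theorem LimitOf.unique {p q r : Baire} (hq : LimitOf p q) (hr : LimitOf p r) : q = r :=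
  tendsto_nhds_unique hq hr

/-- A computable function on limits is the limit of a computable function on the sequences. -/
theorem BaireComputable.exists_lim_lift {F : Baire →. Baire} (hF : BaireComputable F) :
    ∃ L : Baire → Baire, BaireComputable (fun s => Part.some (L s)) ∧
      ∀ s q r, LimitOf s q → r ∈ F q → LimitOf (L s) r := by
  obtain ⟨φ, hφ, mφ, aφ⟩ := hF
  -- Row `i` of the output is `φ` applied to the first `i` digits of row `i` of `s`, padded by
  -- zeros. Each digit of `r` depends on a finite prefix of `q`, with which the rows eventually
  -- agree, so padding and early errors vanish in the limit.
  refine ⟨fun s j => zeroExt (φ (initSeg (fun k => s (Nat.pair j.unpair.1 k)) j.unpair.1))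
    j.unpair.2, .of_local (fun p q j h => ?_) ?_, fun s q r hs hr => ?_⟩
  · rw [initSeg_congr fun k hk => h _ ?_]
    -- Only entries `k < i` of row `i` are read, so all positions lie below `(i + 1) ^ 2`, where `i
    -- ≤ j`.
    have := Nat.pair_lt_max_add_one_sq j.unpair.1 k
    rw [max_eq_left hk.le] at this
    exact this.trans_le (Nat.pow_le_pow_left (by have := Nat.unpair_left_le j; omega) 2)
  · have hu : Computable fun x : List ℕ × ℕ => x.2.unpair :=
      Computable.unpair.comp Computable.snd
    have hrow : Computable₂ fun (x : List ℕ × ℕ) (k : ℕ) =>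
        zeroExt x.1 (Nat.pair x.2.unpair.1 k) :=
      computable_zeroExt.comp (Computable.fst.comp Computable.fst)
        (Primrec₂.natPair.to_comp.comp (Computable.fst.comp (hu.comp Computable.fst))
          Computable.snd)
    exact computable_zeroExt.comp
      (hφ.comp (computable_initSeg hrow (Computable.fst.comp hu))) (Computable.snd.comp hu)
  · rw [limitOf_iff] at hs ⊢
    intro k
    obtain ⟨n, hn⟩ := aφ q r hr (k + 1)
    have hrow : ∀ᶠ i in Filter.atTop, ∀ k ∈ Finset.range n, s (Nat.pair i k) = q k :=
      (Filter.eventually_all_finset _).2 fun k _ => hs k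
    filter_upwards [hrow, Filter.eventually_ge_atTop n] with i hi hni
    simp only [Nat.unpair_pair]
    have h : initSeg q n <+: initSeg (fun k => s (Nat.pair i k)) i := by
      rw [← initSeg_congr fun k hk => hi k (Finset.mem_range.2 hk)]
      exact initSeg_prefix _ hni
    exact zeroExt_of_initSeg_prefix (hn.trans (mφ _ _ h)) (Nat.lt_succ_self k)

/-- From `⟨p, s⟩` one can compute a sequence that converges to `⟨p, lim s⟩`. -/
theorem exists_lim_pair : ∃ L : Baire → Baire, BaireComputable (fun s => Part.some (L s)) ∧
    ∀ p s q, LimitOf s q → LimitOf (L (pair p s)) (pair p q) := by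
  -- Row `i` of the output is `⟨p, sᵢ⟩`, with a constant first component.
  refine ⟨fun u j => if j.unpair.2 % 2 = 0 then fst u (j.unpair.2 / 2)
    else snd u (Nat.pair j.unpair.1 (j.unpair.2 / 2)), .of_local (fun p q j h => ?_) ?_,
    fun p s q hs => ?_⟩
  · have h1 := Nat.unpair_right_le j
    have h2 : Nat.pair j.unpair.1 (j.unpair.2 / 2) ≤ j := by
      conv_rhs => rw [← Nat.pair_unpair j]
      rcases (Nat.div_le_self j.unpair.2 2).eq_or_lt with h | h
      · rw [h]
      · exact (Nat.pair_lt_pair_right _ h).le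
    unfold fst snd
    split_ifs
    · exact h _ (by have := Nat.div_le_self j.unpair.2 2; nlinarith)
    · exact h _ (by nlinarith)
  · have hu : Computable fun x : List ℕ × ℕ => x.2.unpair :=
      Computable.unpair.comp Computable.snd
    have hh := computable_half (Computable.snd.comp hu)
    have hmul := Primrec.nat_mul.to_comp.comp (Computable.const 2)
      (Primrec₂.natPair.to_comp.comp (Computable.fst.comp hu) hh)
    exact computable_ite_even (Computable.snd.comp hu)
      (computable_zeroExt.comp Computable.fst
        (Primrec.nat_mul.to_comp.comp (Computable.const 2) hh))
      (computable_zeroExt.comp Computable.fst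
        (Primrec.nat_add.to_comp.comp hmul (Computable.const 1)))
  · rw [limitOf_iff] at hs ⊢
    intro k
    filter_upwards [hs (k / 2)] with i hi
    simp only [Nat.unpair_pair, fst_pair, snd_pair, hi]
    rfl

universe v u₁ u₂ u₃ u₄ u₅ u₆

namespace MVFun

/-! ### Realizers and reducibility -/

section Reducibility

variable {X : RepSpace.{u₁}} {Y : RepSpace.{u₂}} {Z : RepSpace.{u₃}} {W : RepSpace.{u₄}}
  {A : RepSpace.{u₅}} {B : RepSpace.{u₆}}

theorem _root_.Weihrauch.RepSpace.mem_prod_δ {r : Baire} {x : X.carrier} {y : Y.carrier} :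
    (x, y) ∈ (X.prod Y).δ r ↔ x ∈ X.δ (fst r) ∧ y ∈ Y.δ (snd r) := by
  constructor
  · intro h
    obtain ⟨x', hx, h⟩ := Part.mem_bind_iff.1 h
    obtain ⟨y', hy, h⟩ := (Part.mem_map_iff _).1 h
    obtain ⟨rfl, rfl⟩ := Prod.mk.inj h
    exact ⟨hx, hy⟩
  · exact fun ⟨hx, hy⟩ => Part.mem_bind hx (Part.mem_map _ hy)

/-- `r` is a name of a value of `g` at the point named by `a`. -/
def Solves (g : MVFun Z W) (a r : Baire) : Prop :=
  ∃ z ∈ Z.δ a, ∃ w ∈ W.δ r, w ∈ g.val z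

theorem exists_solves {g : MVFun Z W} {a : Baire} {z : Z.carrier} (hz : z ∈ Z.δ a)
    (hd : z ∈ g.dom) : ∃ r, g.Solves a r := by
  obtain ⟨w, hw⟩ := hd
  obtain ⟨r, hr⟩ := W.surj w
  exact ⟨r, z, hz, w, hr, hw⟩

/-- A partial function that selects a solution wherever there is one realizes `g`. -/
theorem realizes_of_select {g : MVFun Z W} {c : Baire → Baire}
    (hc : ∀ a, (∃ r, g.Solves a r) → g.Solves a (c a)) :
    Realizes (fun a => ⟨∃ r, g.Solves a r, fun _ => c a⟩) g := by
  intro a z hz hd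
  have h := exists_solves hz hd
  obtain ⟨z', hz', w, hw, hg⟩ := hc a h
  obtain rfl := Part.mem_unique hz hz'
  exact ⟨c a, ⟨h, rfl⟩, w, hw, hg⟩

/-- A pointwise form of reducibility: it is enough to look at the instance `H p` and at all of its
solutions. -/
theorem forall_realizes_iff {f : MVFun X Y} {g : MVFun Z W} {H : Baire →. Baire}
    {K : Baire → Baire →. Baire} :
    (∀ G : Baire →. Baire, Realizes G g →
      Realizes (fun p => (H p).bind fun a => (G a).bind (K p)) f) ↔
    ∀ p x, x ∈ X.δ p → x ∈ f.dom → ∃ a ∈ H p, (∃ r, g.Solves a r) ∧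
      ∀ r, g.Solves a r → ∃ s ∈ K p r, ∃ y ∈ Y.δ s, y ∈ f.val x := by
  constructor
  · intro h p x hx hd
    have select : ∀ c : Baire → Baire, (∀ a, (∃ r, g.Solves a r) → g.Solves a (c a)) →
        ∃ a ∈ H p, (∃ r, g.Solves a r) ∧ ∃ s ∈ K p (c a), ∃ y ∈ Y.δ s, y ∈ f.val x := by
      intro c hc
      obtain ⟨s, hs, y, hy, hf⟩ := h _ (realizes_of_select hc) p x hx hd
      obtain ⟨a, ha, hs⟩ := Part.mem_bind_iff.1 hs
      -- The selecting realizer is defined only at solvable instances, so its convergence at `a`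
      -- shows that `a` is solvable.
      obtain ⟨b, ⟨hb, rfl⟩, hs⟩ := Part.mem_bind_iff.1 hs
      exact ⟨a, ha, hb, s, hs, y, hy, hf⟩
    classical
    obtain ⟨c, hc⟩ : ∃ c : Baire → Baire, ∀ a, (∃ r, g.Solves a r) → g.Solves a (c a) :=
      ⟨fun a => if h : ∃ r, g.Solves a r then h.choose else a, fun a h => by
        dsimp only; rw [dif_pos h]; exact h.choose_spec⟩
    obtain ⟨a, ha, hr, -⟩ := select c hc
    refine ⟨a, ha, hr, fun r hr => ?_⟩
    -- The instance `a` does not depend on the realizer, so changing the selector at `a` alone tests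
    -- an arbitrary solution `r`.
    obtain ⟨a', ha', -, hs⟩ := select (Function.update c a r) fun a' h' => by
      rcases eq_or_ne a' a with rfl | hne
      · rwa [Function.update_self]
      · rw [Function.update_of_ne hne]; exact hc a' h'
    obtain rfl := Part.mem_unique ha ha'
    rwa [Function.update_self] at hs
  · intro h G hG p x hx hd
    obtain ⟨a, ha, ⟨r, z, hz, w, hw, hg⟩, hs⟩ := h p x hx hd
    obtain ⟨q, hq, w', hw', hg'⟩ := hG a z hz ⟨w, hg⟩
    obtain ⟨s, hs, hy⟩ := hs q ⟨z, hz, w', hw', hg'⟩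
    exact ⟨s, Part.mem_bind ha (Part.mem_bind hq hs), hy⟩

theorem wReducible_iff {f : MVFun X Y} {g : MVFun Z W} :
    f.WReducible g ↔ ∃ K H : Baire →. Baire, BaireComputable K ∧ BaireComputable H ∧
      ∀ p x, x ∈ X.δ p → x ∈ f.dom → ∃ a ∈ H p, (∃ r, g.Solves a r) ∧
        ∀ r, g.Solves a r → ∃ s ∈ K (pair p r), ∃ y ∈ Y.δ s, y ∈ f.val x :=
  exists_congr fun K => exists_congr fun _ => and_congr_right fun _ => and_congr_right fun _ =>
    forall_realizes_iff (K := fun p b => K (pair p b))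

theorem swReducible_iff {f : MVFun X Y} {g : MVFun Z W} :
    f.SWReducible g ↔ ∃ K H : Baire →. Baire, BaireComputable K ∧ BaireComputable H ∧
      ∀ p x, x ∈ X.δ p → x ∈ f.dom → ∃ a ∈ H p, (∃ r, g.Solves a r) ∧
        ∀ r, g.Solves a r → ∃ s ∈ K r, ∃ y ∈ Y.δ s, y ∈ f.val x :=
  exists_congr fun K => exists_congr fun _ => and_congr_right fun _ => and_congr_right fun _ =>
    forall_realizes_iff (K := fun _ => K)

theorem SWReducible.wReducible {f : MVFun X Y} {g : MVFun Z W} (h : f.SWReducible g) :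
    f.WReducible g := by
  obtain ⟨K, H, hK, hH, h⟩ := swReducible_iff.1 h
  refine wReducible_iff.2 ⟨_, H, hK.comp .snd, hH, fun p x hx hd => ?_⟩
  obtain ⟨a, ha, hr, hs⟩ := h p x hx hd
  refine ⟨a, ha, hr, fun r hr => ?_⟩
  obtain ⟨s, hs, hy⟩ := hs r hr
  exact ⟨s, Part.mem_bind (Part.mem_some _) (by rwa [snd_pair]), hy⟩

theorem SWReducible.trans {f : MVFun X Y} {g : MVFun Z W} {h : MVFun A B}
    (hfg : f.SWReducible g) (hgh : g.SWReducible h) : f.SWReducible h := by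
  obtain ⟨K₁, H₁, hK₁, hH₁, h₁⟩ := hfg
  obtain ⟨K₂, H₂, hK₂, hH₂, h₂⟩ := hgh
  refine ⟨_, _, hK₁.comp hK₂, hH₂.comp hH₁, fun G hG p x hx hd => ?_⟩
  obtain ⟨s, hs, hy⟩ := h₁ _ (h₂ G hG) p x hx hd
  obtain ⟨a, ha, hs⟩ := Part.mem_bind_iff.1 hs
  obtain ⟨b, hb, hs⟩ := Part.mem_bind_iff.1 hs
  obtain ⟨c, hc, hb⟩ := Part.mem_bind_iff.1 hb
  obtain ⟨d, hd, hb⟩ := Part.mem_bind_iff.1 hb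
  exact ⟨s, Part.mem_bind (Part.mem_bind ha hc) (Part.mem_bind hd (Part.mem_bind hb hs)), hy⟩

theorem Extends.swReducible {f h : MVFun X Y} (hfh : f.Extends h) : f.SWReducible h := by
  refine ⟨_, _, .id, .id, fun G hG p x hx hd => ?_⟩
  obtain ⟨q, hq, y, hy, hf⟩ := hG p x hx (hfh.1 hd)
  exact ⟨q, by simpa using hq, y, hy, hfh.2 x hd hf⟩

theorem swReducible_refl (f : MVFun X Y) : f.SWReducible f :=
  Extends.swReducible ⟨subset_rfl, fun _ _ => subset_rfl⟩

/-- The identity factor transports the input: on `⟨p, H p⟩` the answers are exactly the pairs `⟨p,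
r⟩` that `K` expects. -/
theorem WReducible.swReducible_idBaire_prod {f : MVFun X Y} {g : MVFun Z W}
    (h : f.WReducible g) : f.SWReducible (idBaire.prod g) := by
  obtain ⟨K, H, hK, hH, h⟩ := wReducible_iff.1 h
  have solves : ∀ p a r, (idBaire.prod g).Solves (pair p a) r ↔
      fst r = p ∧ g.Solves a (Weihrauch.snd r) := by
    intro p a r
    constructor
    · rintro ⟨⟨z₁, z⟩, hz, ⟨w₁, w⟩, hw, hg₁, hg⟩
      replace hz := RepSpace.mem_prod_δ.1 hz
      replace hw := RepSpace.mem_prod_δ.1 hw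
      rw [fst_pair, snd_pair] at hz
      have hw₁ : w₁ = fst r := Part.mem_some_iff.1 hw.1
      have hz₁ : z₁ = p := Part.mem_some_iff.1 hz.1
      have hg₁ : w₁ = z₁ := hg₁
      exact ⟨hw₁.symm.trans (hg₁.trans hz₁), z, hz.2, w, hw.2, hg⟩
    · rintro ⟨rfl, z, hz, w, hw, hg⟩
      refine ⟨(fst r, z), RepSpace.mem_prod_δ.2 ?_, (fst r, w), RepSpace.mem_prod_δ.2 ?_,
        rfl, hg⟩
      · rw [fst_pair, snd_pair]
        exact ⟨Part.mem_some _, hz⟩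
      · exact ⟨Part.mem_some _, hw⟩
  have pair_eta : ∀ r, pair (fst r) (Weihrauch.snd r) = r := by
    intro r
    funext n
    unfold pair fst Weihrauch.snd
    split_ifs <;> congr 1 <;> omega
  refine swReducible_iff.2 ⟨K, _, hK, hH.pair_id, fun p x hx hd => ?_⟩
  obtain ⟨a, ha, ⟨r, hr⟩, hs⟩ := h p x hx hd
  refine ⟨pair p a, Part.mem_map _ ha, ⟨pair p r, ?_⟩, fun r hr => ?_⟩
  · rw [solves, fst_pair, snd_pair]
    exact ⟨rfl, hr⟩
  · obtain ⟨rfl, hr'⟩ := (solves _ _ _).1 hr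
    rw [← pair_eta r]
    exact hs _ hr'

/-- Below a cylinder, Weihrauch reducibility is strong. -/
theorem IsCylinder.swReducible {f : MVFun X Y} {g : MVFun Z W} (hg : g.IsCylinder)
    (h : f.WReducible g) : f.SWReducible g :=
  h.swReducible_idBaire_prod.trans hg.2

/-! ### Limits and derivatives -/

theorem solves_lim {a r : Baire} : lim.Solves a r ↔ LimitOf a r := by
  constructor
  · rintro ⟨z, hz, w, hw, h⟩
    obtain rfl := Part.mem_some_iff.1 hz
    obtain rfl := Part.mem_some_iff.1 hw
    exact mem_limFun.1 h
  · exact fun h => ⟨a, Part.mem_some a, r, Part.mem_some r, mem_limFun.2 h⟩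

theorem solves_derivative {g : MVFun Z W} {a r : Baire} :
    g.derivative.Solves a r ↔ ∃ q, LimitOf a q ∧ g.Solves q r := by
  constructor
  · rintro ⟨z, hz, hw⟩
    obtain ⟨q, hq, hz⟩ := Part.mem_bind_iff.1 hz
    exact ⟨q, mem_limFun.1 hq, z, hz, hw⟩
  · rintro ⟨q, hq, z, hz, hw⟩
    exact ⟨z, Part.mem_bind (mem_limFun.2 hq) hz, hw⟩

/-- Weihrauch reducibility to `lim` is strong. -/
theorem WReducible.swReducible_lim {f : MVFun X Y} (h : f.WReducible lim) :
    f.SWReducible lim := by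
  obtain ⟨K, H, hK, hH, h⟩ := wReducible_iff.1 h
  -- The constant component `p` survives the limit, so `lim` itself delivers `⟨p, r⟩` to `K`.
  obtain ⟨L, hL, hlim⟩ := exists_lim_pair
  refine swReducible_iff.2 ⟨K, _, hK, hL.comp hH.pair_id, fun p x hx hd => ?_⟩
  obtain ⟨a, ha, ⟨r, hr⟩, hs⟩ := h p x hx hd
  have hr' := hlim p a r (solves_lim.1 hr)
  refine ⟨L (pair p a), Part.mem_bind (Part.mem_map _ ha) (Part.mem_some _),
    ⟨_, solves_lim.2 hr'⟩, fun r' hr'' => ?_⟩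
  obtain rfl := hr'.unique (solves_lim.1 hr'')
  exact hs r hr

/-- The computable map `H₂ ∘ K₁` between the two oracle calls is lifted to sequences. The lifted
sequence names an instance of `g'`, and `K₂` reads off the answer. The domain convention for
compositions ensures that whichever value of `l₀` arises lies in the domain of `g₀`. -/
theorem comp_swReducible_derivative {V : RepSpace.{v}} {g : MVFun Z W} {g₀ : MVFun V Y}
    {l₀ : MVFun X V} (hg : g₀.SWReducible g) (hl : l₀.SWReducible lim) :
    (g₀.comp l₀).SWReducible g.derivative := by
  obtain ⟨K₁, H₁, hK₁, hH₁, h₁⟩ := swReducible_iff.1 hl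
  obtain ⟨K₂, H₂, hK₂, hH₂, h₂⟩ := swReducible_iff.1 hg
  obtain ⟨L, hL, hlim⟩ := (hH₂.comp hK₁).exists_lim_lift
  refine swReducible_iff.2 ⟨K₂, _, hK₂, hL.comp hH₁, ?_⟩
  rintro p x hx ⟨y, hsub, v, hv, hy⟩
  obtain ⟨a, ha, ⟨q, hq⟩, hs⟩ := h₁ p x hx ⟨v, hv⟩
  obtain ⟨s, hs, v, hvs, hv⟩ := hs q hq
  obtain ⟨b, hb, ⟨r, hr⟩, hr'⟩ := h₂ s v hvs (hsub hv)
  have hLa := hlim a q b (solves_lim.1 hq) (Part.mem_bind hs hb)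
  refine ⟨L a, Part.mem_bind ha (Part.mem_some _), ⟨r, solves_derivative.2 ⟨b, hLa, hr⟩⟩,
    fun r hr => ?_⟩
  obtain ⟨b', hb', hr⟩ := solves_derivative.1 hr
  obtain rfl := hLa.unique hb'
  obtain ⟨s, hs, y, hys, hy⟩ := hr' r hr
  exact ⟨s, hs, y, hys, hsub, v, hv, hy⟩

end Reducibility

/-! ### Decompositions below the derivative -/

/-- A copy of Baire space in any universe, represented by the identity. -/
def _root_.Weihrauch.RepSpace.names : RepSpace.{u} where
  carrier := ULift.{u} Baire
  δ := fun p => Part.some ⟨p⟩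
  surj := fun x => ⟨x.down, Part.mem_some x⟩

section Decomposition

variable {X : RepSpace.{u₁}} {Y : RepSpace.{u₂}} {Z : RepSpace.{u₃}} {W : RepSpace.{u₄}}

/-- The intermediate points are `⟨p, q⟩`, with `p` a name of `x` and `q` the limit of `H p`. Since
`p` determines `x`, the problem `g₀` may allow all of `f(x)`, hence the equality. -/
theorem WReducible.exists_eq_comp {f : MVFun X Y} {g : MVFun Z W}
    (h : f.WReducible g.derivative) :
    ∃ (g₀ : MVFun RepSpace.names.{u} Y) (l₀ : MVFun X RepSpace.names.{u}),
      g₀.WReducible g ∧ l₀.WReducible lim ∧ f = g₀.comp l₀ := by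
  obtain ⟨K, H, hK, hH, h⟩ := wReducible_iff.1 h
  let Inst (t : Baire) (x : X.carrier) : Prop :=
    x ∈ X.δ (fst t) ∧ x ∈ f.dom ∧ ∃ a ∈ H (fst t), LimitOf a (Weihrauch.snd t)
  have hval : ∀ {t x y}, Inst t x → (y ∈ f.val x ↔ ∃ x', Inst t x' ∧ y ∈ f.val x') := by
    rintro t x y hx
    refine ⟨fun hy => ⟨x, hx, hy⟩, fun ⟨x', hx', hy⟩ => ?_⟩
    obtain rfl := Part.mem_unique hx.1 hx'.1
    exact hy
  have hinst : ∀ p x, x ∈ X.δ p → x ∈ f.dom → ∃ a ∈ H p, ∃ q, LimitOf a q ∧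
      Inst (pair p q) x := by
    intro p x hx hd
    obtain ⟨a, ha, ⟨r, hr⟩, -⟩ := h p x hx hd
    obtain ⟨q, hq, -⟩ := solves_derivative.1 hr
    exact ⟨a, ha, q, hq, by rwa [fst_pair], hd, a, by rwa [fst_pair], by rwa [snd_pair]⟩
  let g₀ : MVFun RepSpace.names.{u} Y := ⟨fun t => {y | ∃ x, Inst t.down x ∧ y ∈ f.val x}⟩
  let l₀ : MVFun X RepSpace.names.{u} := ⟨fun x => {t | Inst t.down x}⟩
  refine ⟨g₀, l₀, wReducible_iff.2 ?_, wReducible_iff.2 ?_, ?_⟩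
  -- The instance of `g` is `q`; from `⟨⟨p, q⟩, r⟩` the map `K` needs only `⟨p, r⟩`.
  · refine ⟨_, _, hK.comp .pair_fst_fst_snd, .snd, ?_⟩
    rintro t t' ht ⟨y, x, hx, -⟩
    obtain rfl := Part.mem_some_iff.1 ht
    obtain ⟨hxt, hd, a, ha, hlim⟩ := hx
    obtain ⟨a', ha', ⟨r, hr⟩, hs⟩ := h _ x hxt hd
    obtain rfl := Part.mem_unique ha ha'
    refine ⟨_, Part.mem_some _, ⟨r, ?_⟩, fun r hr => ?_⟩
    · obtain ⟨q, hq, hr⟩ := solves_derivative.1 hr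
      obtain rfl := hq.unique hlim
      exact hr
    · obtain ⟨s, hs, y, hys, hy⟩ := hs r (solves_derivative.2 ⟨_, hlim, hr⟩)
      refine ⟨s, Part.mem_bind (Part.mem_some _) ?_, y, hys, x, ⟨hxt, hd, a, ha, hlim⟩, hy⟩
      rwa [fst_pair, snd_pair]
  -- No postprocessing is needed: input and limit together already form the intermediate point.
  · refine ⟨_, H, .id, hH, fun p x hx hd => ?_⟩
    obtain ⟨t, ht⟩ := hd
    obtain ⟨a, ha, q, hq, hi⟩ := hinst p x hx ht.2.1
    refine ⟨a, ha, ⟨q, solves_lim.2 hq⟩, fun r hr => ?_⟩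
    obtain rfl := hq.unique (solves_lim.1 hr)
    exact ⟨_, Part.mem_some _, _, Part.mem_some _, hi⟩
  · ext x y
    constructor
    · intro hy
      obtain ⟨p, hp⟩ := X.surj x
      obtain ⟨a, ha, q, hq, hi⟩ := hinst p x hp ⟨y, hy⟩
      refine ⟨?_, ⟨pair p q⟩, hi, x, hi, hy⟩
      rintro t ht
      obtain ⟨y', hy'⟩ := ht.2.1
      exact ⟨y', x, ht, hy'⟩
    · rintro ⟨-, t, ht, hy⟩
      exact (hval ht).2 hy

/-- Here the intermediate point is the limit `q` alone, which may come from several `x`. So the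
values of `g₀` are just what `K` makes of the solutions of `q`; they lie in `f(x)` for each such `x`
but need not exhaust it. -/
theorem SWReducible.exists_extends_comp {f : MVFun X Y} {g : MVFun Z W}
    (h : f.SWReducible g.derivative) :
    ∃ (g₀ : MVFun RepSpace.names.{u} Y) (l₀ : MVFun X RepSpace.names.{u}),
      g₀.SWReducible g ∧ l₀.SWReducible lim ∧ f.Extends (g₀.comp l₀) := by
  obtain ⟨K, H, hK, hH, h⟩ := swReducible_iff.1 h
  -- Without this restriction on the domain of `g₀`, some solution of `q` could be one on which `K`
  -- fails, and `K` would not witness the reduction of `g₀` to `g`.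
  let Good (q : Baire) : Prop := ∀ r, g.Solves q r → ∃ s ∈ K r, ∃ y, y ∈ Y.δ s
  let g₀ : MVFun RepSpace.names.{u} Y :=
    ⟨fun q => {y | Good q.down ∧ ∃ r, g.Solves q.down r ∧ ∃ s ∈ K r, y ∈ Y.δ s}⟩
  let l₀ : MVFun X RepSpace.names.{u} :=
    ⟨fun x => {q | x ∈ f.dom ∧ ∃ p, x ∈ X.δ p ∧ ∃ a ∈ H p, LimitOf a q.down}⟩
  have hlim : ∀ {p x}, x ∈ X.δ p → x ∈ f.dom → ∃ a ∈ H p, ∃ q, LimitOf a q ∧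
      (∃ r, g.Solves q r) ∧ ∀ r, g.Solves q r → ∃ s ∈ K r, ∃ y ∈ Y.δ s, y ∈ f.val x := by
    intro p x hx hd
    obtain ⟨a, ha, ⟨r, hr⟩, hs⟩ := h p x hx hd
    obtain ⟨q, hq, hr⟩ := solves_derivative.1 hr
    exact ⟨a, ha, q, hq, ⟨r, hr⟩, fun r hr => hs r (solves_derivative.2 ⟨q, hq, hr⟩)⟩
  have hl₀ : ∀ {x q}, q ∈ l₀.val x → (∃ r, g.Solves q.down r) ∧
      ∀ r, g.Solves q.down r → ∃ s ∈ K r, ∃ y ∈ Y.δ s, y ∈ f.val x := by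
    rintro x q ⟨hd, p, hx, a, ha, hq⟩
    obtain ⟨a', ha', q', hq', hr⟩ := hlim hx hd
    obtain rfl := Part.mem_unique ha ha'
    obtain rfl := hq.unique hq'
    exact hr
  have hg₀ : ∀ {x}, l₀.val x ⊆ g₀.dom := by
    intro x q hq
    obtain ⟨⟨r, hr⟩, hs⟩ := hl₀ hq
    obtain ⟨s, hsK, y, hy, -⟩ := hs r hr
    refine ⟨y, fun r hr => ?_, r, hr, s, hsK, hy⟩
    obtain ⟨s, hsK, y, hy, -⟩ := hs r hr
    exact ⟨s, hsK, y, hy⟩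
  refine ⟨g₀, l₀, swReducible_iff.2 ?_, swReducible_iff.2 ?_, fun x hd => ?_, fun x _ y hy => ?_⟩
  · refine ⟨K, _, hK, .id, ?_⟩
    rintro q q' hq ⟨y, hgood, r, hr, -⟩
    obtain rfl := Part.mem_some_iff.1 hq
    refine ⟨q, Part.mem_some q, ⟨r, hr⟩, fun r hr => ?_⟩
    obtain ⟨s, hs, y, hy⟩ := hgood r hr
    exact ⟨s, hs, y, hy, hgood, r, hr, s, hs, hy⟩
  · refine ⟨_, H, .id, hH, ?_⟩
    rintro p x hx ⟨-, hd, -⟩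
    obtain ⟨a, ha, q, hq, -⟩ := hlim hx hd
    refine ⟨a, ha, ⟨q, solves_lim.2 hq⟩, fun r hr => ?_⟩
    exact ⟨r, Part.mem_some r, ⟨r⟩, Part.mem_some _, hd, p, hx, a, ha, solves_lim.1 hr⟩
  · obtain ⟨p, hx⟩ := X.surj x
    obtain ⟨a, ha, q, hq, -⟩ := hlim hx hd
    have hmem : (⟨q⟩ : ULift Baire) ∈ l₀.val x := ⟨hd, p, hx, a, ha, hq⟩
    obtain ⟨y, hy⟩ := hg₀ hmem
    exact ⟨y, hg₀, _, hmem, hy⟩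
  -- `K` and the representation are single-valued, so the value obtained without reference to `x` is
  -- the one known to lie in `f(x)`.
  · obtain ⟨-, q, hq, -, r, hr, s, hs, hy⟩ := hy
    obtain ⟨s', hs', y', hy', hf⟩ := (hl₀ hq).2 r hr
    obtain rfl := Part.mem_unique hs hs'
    obtain rfl := Part.mem_unique hy hy'
    exact hf

end Decomposition

/-- For a cylinder `g`, compositions of problems below `g` and below `lim` are below `g'`. -/
theorem IsCylinder.comp_wReducible_derivative {X : RepSpace.{u₁}} {Y : RepSpace.{u₂}}
    {Z : RepSpace.{u₃}} {W : RepSpace.{u₄}} {V : RepSpace.{v}} {g : MVFun Z W}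
    (hg : g.IsCylinder) {g₀ : MVFun V Y} {l₀ : MVFun X V} (hg₀ : g₀.WReducible g)
    (hl₀ : l₀.WReducible lim) : (g₀.comp l₀).WReducible g.derivative :=
  (comp_swReducible_derivative (hg.swReducible hg₀) hl₀.swReducible_lim).wReducible

end MVFun

end Weihrauch

theorem mainTheorem4 {Z W : Weihrauch.RepSpace.{u}} (g : Weihrauch.MVFun Z W) :
    (g.IsCylinder →
      ∀ (X Y : Weihrauch.RepSpace.{u}) (f : Weihrauch.MVFun X Y),
        f.WReducible g.derivative ↔
          ∃ (V : Weihrauch.RepSpace.{u}) (g₀ : Weihrauch.MVFun V Y) (l₀ : Weihrauch.MVFun X V),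
            g₀.WReducible g ∧ l₀.WReducible Weihrauch.MVFun.lim ∧ f = g₀.comp l₀) ∧
    (∀ (X Y : Weihrauch.RepSpace.{u}) (f : Weihrauch.MVFun X Y),
        f.SWReducible g.derivative ↔
          ∃ (V : Weihrauch.RepSpace.{u}) (g₀ : Weihrauch.MVFun V Y) (l₀ : Weihrauch.MVFun X V),
            g₀.SWReducible g ∧ l₀.SWReducible Weihrauch.MVFun.lim ∧ f.Extends (g₀.comp l₀)) ∧
    (∀ (X Y : Weihrauch.RepSpace.{u}) (f : Weihrauch.MVFun X Y),
        f.SWReducible g.derivative ↔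
          ∃ (A V B : Weihrauch.RepSpace.{u})
            (g₀ : Weihrauch.MVFun V B) (l₀ : Weihrauch.MVFun A V),
            g₀.SWReducible g ∧ l₀.SWReducible Weihrauch.MVFun.lim ∧
              f.SWReducible (g₀.comp l₀)) ∧
    (g.IsCylinder → g.derivative.IsCompProduct g Weihrauch.MVFun.lim) ∧
    g.derivative.IsStrongCompProduct g Weihrauch.MVFun.lim := by
  refine ⟨fun hg X Y f => ⟨fun h => ?_, ?_⟩, fun X Y f => ⟨fun h => ?_, ?_⟩,
    fun X Y f => ⟨fun h => ?_, ?_⟩, fun hg => ⟨?_, fun C D k hk => ?_⟩, ?_, fun C D k hk => ?_⟩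
  · exact ⟨_, h.exists_eq_comp⟩
  · rintro ⟨V, g₀, l₀, hg₀, hl₀, rfl⟩
    exact hg.comp_wReducible_derivative hg₀ hl₀
  · exact ⟨_, h.exists_extends_comp⟩
  · rintro ⟨V, g₀, l₀, hg₀, hl₀, hf⟩
    exact hf.swReducible.trans (Weihrauch.MVFun.comp_swReducible_derivative hg₀ hl₀)
  · obtain ⟨g₀, l₀, hg₀, hl₀, hf⟩ := h.exists_extends_comp
    exact ⟨_, _, _, g₀, l₀, hg₀, hl₀, hf.swReducible⟩
  · rintro ⟨A, V, B, g₀, l₀, hg₀, hl₀, hf⟩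
    exact hf.trans (Weihrauch.MVFun.comp_swReducible_derivative hg₀ hl₀)
  · exact fun A V B g₀ l₀ hg₀ hl₀ => hg.comp_wReducible_derivative hg₀ hl₀
  -- By reflexivity `g'` is itself one of the compositions that `k` bounds.
  · obtain ⟨g₀, l₀, hg₀, hl₀, hf⟩ :=
      (Weihrauch.MVFun.swReducible_refl g.derivative).wReducible.exists_eq_comp
    rw [hf]
    exact hk _ _ _ g₀ l₀ hg₀ hl₀
  · exact fun A V B g₀ l₀ hg₀ hl₀ => Weihrauch.MVFun.comp_swReducible_derivative hg₀ hl₀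
  -- Here `g'` only extends such a composition, but that already reduces it strongly to the
  -- composition.
  · obtain ⟨g₀, l₀, hg₀, hl₀, hf⟩ :=
      (Weihrauch.MVFun.swReducible_refl g.derivative).exists_extends_comp
    exact hf.swReducible.trans (hk _ _ _ g₀ l₀ hg₀ hl₀)
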